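/- Let $k$ be a field of characteristic $2$, let $V=k[[t]]$ with order function $\mathrm{o}(\cdot)$, and let $A=k[[t^5,t^{11}]]\subseteq V$, that is, the local ring of all power series $\sum_h c_ht^h$ with $h$ running over the numerical semigroup $\langle 5,11\rangle$. An ideal $I$ of a Cohen–Macaulay local ring $(R,\mathfrak m)$ is called an Ulrich ideal if it is $\mathfrak m$-primary, contains a parameter ideal $Q$ of $R$ as a reduction with $I\neq Q$ and $I^2=QI$, and $I/I^2$ is a free $R/I$-module. An ideal $I$ of $A$ is said to possess the data $(a,b)$ if there are $f,g\in I$ with $I=(f,g)$, $I^2=fI$, $\mathrm{o}(f)=a$ and $\mathrm{o}(g)=b$. Let $\mathcal Y_A$ be the set of Ulrich ideals of $A$ which possess the data $(a,b)=(20,26)$. Then $$\mathcal Y_A=\{(t^{20}+\alpha t^{21}+\alpha^2t^{22}+\alpha^7t^{27}+\delta t^{33},\ t^{26}+\tau t^{33})\mid \alpha,\delta,\tau\in k,\ \alpha\neq 0\}.$$ -/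

import Mathlib

open PowerSeries

/-- The semigroup ring `k[[H]]` of an additive submonoid `H` of `ℕ`: the `k`-subalgebra of
`V = k[[t]]` of all power series `∑ c_h t^h` whose exponents `h` run over `H`. For
`H = ⟨a₁, …, a_ℓ⟩` this is `k[[t^{a₁}, …, t^{a_ℓ}]]`. -/
def semigroupRing (k : Type*) [Field k] (H : AddSubmonoid ℕ) : Subalgebra k k⟦X⟧ where
  carrier := {f | ∀ n, coeff n f ≠ 0 → n ∈ H}
  mul_mem' := by
    intro f g hf hg n hn
    rw [coeff_mul] at hn
    obtain ⟨p, hp, hne⟩ := Finset.exists_ne_zero_of_sum_ne_zero hn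
    rw [← Finset.HasAntidiagonal.mem_antidiagonal.mp hp]
    exact H.add_mem (hf _ (left_ne_zero_of_mul hne)) (hg _ (right_ne_zero_of_mul hne))
  add_mem' := by
    intro f g hf hg n hn
    by_contra h
    have h1 : coeff n f = 0 := by
      by_contra h'
      exact h (hf n h')
    have h2 : coeff n g = 0 := by
      by_contra h'
      exact h (hg n h')
    exact hn (by rw [map_add, h1, h2, add_zero])
  algebraMap_mem' := by
    intro r n hn
    rw [PowerSeries.algebraMap_apply, Algebra.algebraMap_self, RingHom.id_apply, coeff_C] at hn
    split_ifs at hn with h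
    · rw [h]
      exact H.zero_mem
    · exact absurd rfl hn

theorem semigroupRing_inv_mem {k : Type*} [Field k] {H : AddSubmonoid ℕ} {f : k⟦X⟧}
    (hf : f ∈ semigroupRing k H) : f⁻¹ ∈ semigroupRing k H := by
  intro n
  induction n using Nat.strong_induction_on with
  | _ n ih =>
    intro hn
    rw [PowerSeries.coeff_inv] at hn
    split_ifs at hn with h
    · rw [h]
      exact H.zero_mem
    · obtain ⟨p, hp, hne⟩ := Finset.exists_ne_zero_of_sum_ne_zero (right_ne_zero_of_mul hn)
      split_ifs at hne with hlt
      · rw [← Finset.HasAntidiagonal.mem_antidiagonal.mp hp]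
        exact H.add_mem (hf _ (left_ne_zero_of_mul hne))
          (ih _ hlt (right_ne_zero_of_mul hne))
      · exact absurd rfl hne

theorem semigroupRing_isUnit {k : Type*} [Field k] {H : AddSubmonoid ℕ}
    (f : semigroupRing k H) (hf : constantCoeff (f : k⟦X⟧) ≠ 0) : IsUnit f :=
  IsUnit.of_mul_eq_one ⟨(f : k⟦X⟧)⁻¹, semigroupRing_inv_mem f.2⟩
    (Subtype.ext (PowerSeries.mul_inv_cancel _ hf))

instance semigroupRing_isLocalRing (k : Type*) [Field k] (H : AddSubmonoid ℕ) :
    IsLocalRing (semigroupRing k H) :=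
  IsLocalRing.of_isUnit_or_isUnit_one_sub_self fun f => by
    by_cases hf : constantCoeff (f : k⟦X⟧) = 0
    · right
      apply semigroupRing_isUnit
      simp [hf]
    · left
      exact semigroupRing_isUnit f hf

/-- `Q` is a parameter ideal of the local ring `R`: it is primary to the maximal ideal and
generated by `d = dim R` elements. -/
def IsParameterIdeal {R : Type*} [CommRing R] [IsLocalRing R] (Q : Ideal R) : Prop :=
  Q.radical = IsLocalRing.maximalIdeal R ∧
    ∃ (d : ℕ) (x : Fin d → R), ringKrullDim R = d ∧ Q = Ideal.span (Set.range x)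

/-- `Q` is a reduction of `I`. -/
def IsReductionOf {R : Type*} [CommRing R] (Q I : Ideal R) : Prop :=
  Q ≤ I ∧ ∃ n : ℕ, I ^ (n + 1) = Q * I ^ n

/-- `I` is an Ulrich ideal of the (Cohen–Macaulay) local ring `R`: it is primary to the maximal
ideal, it contains a parameter ideal `Q` as a reduction with `I ≠ Q` and `I² = QI`, and `I/I²`
(`Ideal.Cotangent I` in Mathlib) is a free `R/I`-module. -/
def IsUlrich {R : Type*} [CommRing R] [IsLocalRing R] (I : Ideal R) : Prop :=
  I.radical = IsLocalRing.maximalIdeal R ∧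
  (∃ Q : Ideal R, IsParameterIdeal Q ∧ IsReductionOf Q I ∧ I ≠ Q ∧ I ^ 2 = Q * I) ∧
  Module.Free (R ⧸ I) I.Cotangent

/-- The ideal `I` of `A ⊆ k[[t]]` possesses the data `(a, b)`: one has `I = (f, g)` and
`I² = fI` for some `f, g` with `o(f) = a` and `o(g) = b`, where `o` is the order in `k[[t]]`. -/
def HasData {k : Type*} [Field k] {A : Subalgebra k k⟦X⟧} (I : Ideal A) (a b : ℕ) : Prop :=
  ∃ f g : A, I = Ideal.span {f, g} ∧ I ^ 2 = Ideal.span {f} * I ∧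
    (f : k⟦X⟧).order = a ∧ (g : k⟦X⟧).order = b

/-! Suppose `I = (f, g)` and `I² = fI` with orders 20 and 26. Multiplication by `g/f` preserves `I`
and raises orders by 6, so every element of `20 + ⟨5, 6⟩` is an order in `I`. The symmetry of `⟨5,
6⟩` and the gap 39 of `⟨5, 11⟩` exclude all other orders (`order_of_mul_mem_span_singleton`). Hence
`I` contains everything of order at least 40, and `(f) : g = I`, which makes `I/I²` free on `f, g`.
The data alone thus force the Ulrich property (`isUlrich_of_hasData`).

Elimination by orders reduces `f` to the exponents 20, 21, 22, 27, 33 and `g` to 26, 27, 33. With `w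
= g²/f` in `I`, comparing coefficients in `fw = g²`, in characteristic 2 and with the gaps 34 and
39, leaves only `α, δ, τ` (`coeff_relations`). Conversely, for a normal form, cancellations in
characteristic 2 produce the orders 32, 38, 44 in `(f, g)`, and an approximation of `g²/f` modulo
`t⁴⁰` gives `g² ∈ fI` (`hasData_of_normalForm`). -/

theorem PowerSeries.X_pow_dvd_iff_le_order {k : Type*} [Field k] {z : k⟦X⟧} {n : ℕ} :
    X ^ n ∣ z ↔ (n : ℕ∞) ≤ z.order := by
  rw [X_pow_dvd_iff]
  refine ⟨fun h => nat_le_order _ _ h, fun h m hm => coeff_of_lt_order _ (lt_of_lt_of_le ?_ h)⟩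
  exact_mod_cast hm

theorem PowerSeries.exists_mul_eq_of_le_order {k : Type*} [Field k] {x z : k⟦X⟧} {a n : ℕ}
    (hx : x.order = a) (hz : ((a + n : ℕ) : ℕ∞) ≤ z.order) :
    ∃ w : k⟦X⟧, x * w = z ∧ (n : ℕ∞) ≤ w.order := by
  obtain ⟨u, hu⟩ := X_pow_dvd_iff_le_order.2 hx.ge
  obtain ⟨v, hv⟩ := X_pow_dvd_iff_le_order.2 hz
  have hu0 : constantCoeff u ≠ 0 := by
    have h := (order_eq_nat.1 hx).1
    rwa [hu, coeff_X_pow_mul', if_pos le_rfl, Nat.sub_self, coeff_zero_eq_constantCoeff_apply] at h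
  refine ⟨X ^ n * (u⁻¹ * v), ?_, X_pow_dvd_iff_le_order.1 (Dvd.intro _ rfl)⟩
  have := PowerSeries.mul_inv_cancel u hu0
  rw [hu, hv, pow_add]
  linear_combination X ^ a * X ^ n * v * this

theorem PowerSeries.exists_succ_le_order_sub {k : Type*} [Field k] {z e : k⟦X⟧} {n : ℕ}
    (hz : (n : ℕ∞) ≤ z.order) (he : e.order = n) :
    ∃ c : k, ((n + 1 : ℕ) : ℕ∞) ≤ (z - C c * e).order := by
  have he0 := (order_eq_nat.1 he).1
  refine ⟨coeff n z / coeff n e, nat_le_order _ _ fun i hi => ?_⟩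
  rw [map_sub, coeff_C_mul]
  rcases Nat.lt_succ_iff_lt_or_eq.1 hi with h | rfl
  · rw [(order_eq_nat.1 he).2 i h,
      coeff_of_lt_order _ (lt_of_lt_of_le (by exact_mod_cast h) hz), mul_zero, sub_zero]
  · rw [div_mul_cancel₀ _ he0, sub_self]

theorem PowerSeries.order_eq_of_mul_eq {k : Type*} [Field k] {x w z : k⟦X⟧} {a n : ℕ}
    (hx : x.order = a) (hz : z.order = (a + n : ℕ)) (h : x * w = z) : w.order = n := by
  have := congrArg order h
  rw [order_mul, hx, hz, Nat.cast_add] at this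
  exact ENat.add_right_injective_of_ne_top (ENat.natCast_ne_top a) this

/-! ### Ideals of a semigroup ring, compared through orders. -/

section SemigroupRing

variable {k : Type*} [Field k] {H : AddSubmonoid ℕ}

theorem semigroupRing_mem_of_order_eq (f : semigroupRing k H) {n : ℕ}
    (h : (f : k⟦X⟧).order = n) : n ∈ H :=
  f.2 n (order_eq_nat.1 h).1

theorem coe_algebraMap_semigroupRing (c : k) :
    ((algebraMap k (semigroupRing k H) c : semigroupRing k H) : k⟦X⟧) = C c := rfl

/-- An ideal `J` lies in `I` as soon as `I` contains all elements of large order, and an element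
of `I ∩ J` of each of the smaller orders that occur in `J`. -/
theorem ideal_le_of_orders {I J : Ideal (semigroupRing k H)} (N : ℕ)
    (hN : ∀ z ∈ J, (N : ℕ∞) ≤ (z : k⟦X⟧).order → z ∈ I)
    (h : ∀ z ∈ J, ∀ n < N, (z : k⟦X⟧).order = n →
      ∃ e ∈ I, e ∈ J ∧ (e : k⟦X⟧).order = n) : J ≤ I := by
  have key : ∀ m : ℕ, ∀ z ∈ J, ((N - m : ℕ) : ℕ∞) ≤ (z : k⟦X⟧).order → z ∈ I := by
    intro m
    induction m with
    | zero => simpa using hN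
    | succ m ih =>
      intro z hz hord
      -- Truncated subtraction: once `m ≥ N` the bound stays at 0.
      by_cases hm : N - (m + 1) = N - m
      · exact ih z hz (hm ▸ hord)
      have hs : N - (m + 1) + 1 = N - m := by omega
      rcases hord.lt_or_eq with hlt | heq
      · apply ih z hz
        rw [← hs]
        exact_mod_cast Order.add_one_le_of_lt hlt
      · obtain ⟨e, heI, heJ, he⟩ := h z hz _ (by omega) heq.symm
        obtain ⟨c, hc⟩ := exists_succ_le_order_sub hord he
        have hmem := ih (z - algebraMap k _ c * e) (J.sub_mem hz (J.mul_mem_left _ heJ))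
          (by rw [← hs]; exact hc)
        simpa using I.add_mem hmem (I.mul_mem_left (algebraMap k _ c) heI)
  intro z hz
  exact key N z hz (by simp)

theorem one_le_order_of_mem_maximalIdeal {z : semigroupRing k H}
    (hz : z ∈ IsLocalRing.maximalIdeal (semigroupRing k H)) : 1 ≤ (z : k⟦X⟧).order := by
  rw [one_le_order_iff_constCoeff_eq_zero]
  by_contra h
  exact (IsLocalRing.mem_maximalIdeal _).1 hz (semigroupRing_isUnit z h)

/-- An ideal containing all elements of large order is the unit ideal or is primary to the maximal
ideal. -/
theorem maximalIdeal_le_radical {I : Ideal (semigroupRing k H)} (N : ℕ)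
    (hN : ∀ z : semigroupRing k H, (N : ℕ∞) ≤ (z : k⟦X⟧).order → z ∈ I) :
    IsLocalRing.maximalIdeal (semigroupRing k H) ≤ I.radical := by
  refine fun z hz => ⟨N, hN _ ?_⟩
  rw [SubmonoidClass.coe_pow, order_pow, nsmul_eq_mul]
  exact le_mul_of_one_le_right' (one_le_order_of_mem_maximalIdeal hz)

theorem radical_eq_maximalIdeal {I : Ideal (semigroupRing k H)} (N : ℕ)
    (hN : ∀ z : semigroupRing k H, (N : ℕ∞) ≤ (z : k⟦X⟧).order → z ∈ I) (hI : I ≠ ⊤) :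
    I.radical = IsLocalRing.maximalIdeal (semigroupRing k H) :=
  ((IsLocalRing.maximalIdeal.isMaximal _).eq_of_le (mt Ideal.radical_eq_top.1 hI)
    (maximalIdeal_le_radical N hN)).symm

end SemigroupRing

/-! ### The ring `k[[t⁵, t¹¹]]`. -/

/-- Since `11 ≡ 1` mod 5, the least element of the semigroup congruent to `j < 5` is `11j`. This
form lets `omega` decide membership. -/
theorem mem_closure_five_eleven {n : ℕ} :
    n ∈ AddSubmonoid.closure ({5, 11} : Set ℕ) ↔ 11 * (n % 5) ≤ n := by
  rw [AddSubmonoid.mem_closure_pair]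
  simp only [smul_eq_mul]
  constructor
  · rintro ⟨a, b, rfl⟩
    have h1 : (a * 5 + b * 11) % 5 = b % 5 := by omega
    have h2 := Nat.mod_le b 5
    omega
  · intro h
    exact ⟨(n - 11 * (n % 5)) / 5, n % 5, by omega⟩

/-- The ring `k[[t⁵, t¹¹]]`. -/
abbrev ringFiveEleven (k : Type*) [Field k] : Subalgebra k k⟦X⟧ :=
  semigroupRing k (AddSubmonoid.closure {5, 11})

section FiveEleven

variable {k : Type*} [Field k]

theorem mem_ringFiveEleven_of_le_order {z : k⟦X⟧} (hz : 40 ≤ z.order) :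
    z ∈ ringFiveEleven k := by
  intro n hn
  rw [mem_closure_five_eleven]
  by_contra h
  have h : n < 40 := by omega
  exact hn (coeff_of_lt_order _ (lt_of_lt_of_le (by exact_mod_cast h) hz))

theorem ringFiveEleven_exists_mul_eq {x z : ringFiveEleven k} {a n : ℕ} (hn : 40 ≤ n)
    (hx : (x : k⟦X⟧).order = a) (hz : ((a + n : ℕ) : ℕ∞) ≤ (z : k⟦X⟧).order) :
    ∃ w : ringFiveEleven k, x * w = z ∧ (n : ℕ∞) ≤ (w : k⟦X⟧).order := by
  obtain ⟨w, hw, hw'⟩ := exists_mul_eq_of_le_order hx hz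
  exact ⟨⟨w, mem_ringFiveEleven_of_le_order (le_trans (by exact_mod_cast hn) hw')⟩,
    Subtype.ext hw, hw'⟩

theorem ringFiveEleven_mem_span_singleton {x z : ringFiveEleven k} {a : ℕ}
    (hx : (x : k⟦X⟧).order = a) (hz : ((a + 40 : ℕ) : ℕ∞) ≤ (z : k⟦X⟧).order) :
    z ∈ Ideal.span {x} := by
  obtain ⟨w, hw, -⟩ := ringFiveEleven_exists_mul_eq le_rfl hx hz
  exact Ideal.mem_span_singleton.2 ⟨w, hw.symm⟩

theorem X_pow_mem_ringFiveEleven {n : ℕ} (h : 11 * (n % 5) ≤ n) :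
    (X : k⟦X⟧) ^ n ∈ ringFiveEleven k := by
  intro m hm
  rw [coeff_X_pow] at hm
  split_ifs at hm with hmn
  · exact mem_closure_five_eleven.2 (hmn ▸ h)
  · exact absurd rfl hm

variable (k) in
/-- The element `t⁵`. -/
noncomputable def tFive : ringFiveEleven k := ⟨X ^ 5, X_pow_mem_ringFiveEleven (by norm_num)⟩

variable (k) in
/-- The element `t¹¹`. -/
noncomputable def tEleven : ringFiveEleven k := ⟨X ^ 11, X_pow_mem_ringFiveEleven (by norm_num)⟩

theorem coe_tFive : (tFive k : k⟦X⟧) = X ^ 5 := rfl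

theorem coe_tEleven : (tEleven k : k⟦X⟧) = X ^ 11 := rfl

theorem order_tFive_pow_mul {e : ringFiveEleven k} {n : ℕ} (i : ℕ)
    (he : (e : k⟦X⟧).order = n) :
    ((tFive k ^ i * e : ringFiveEleven k) : k⟦X⟧).order = (5 * i + n : ℕ) := by
  rw [MulMemClass.coe_mul, SubmonoidClass.coe_pow, coe_tFive, ← pow_mul, order_mul, order_X_pow,
    he, Nat.cast_add]

variable (k) in
theorem ringKrullDim_ringFiveEleven : ringKrullDim (ringFiveEleven k) = 1 := by
  rw [ringKrullDim_eq_one_iff_of_isLocalRing_isDomain]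
  constructor
  · intro h
    have h0 : tFive k ≠ 0 := fun h => by
      have := congrArg (fun z : ringFiveEleven k => coeff 5 (z : k⟦X⟧)) h
      simp [coe_tFive, coeff_X_pow] at this
    obtain ⟨b, hb⟩ := h.mul_inv_cancel h0
    have := congrArg (fun z : ringFiveEleven k => constantCoeff (z : k⟦X⟧)) hb
    simp [coe_tFive] at this
  · intro x hx
    have hx' : (x : k⟦X⟧) ≠ 0 := fun h => hx (Subtype.ext h)
    exact maximalIdeal_le_radical _ fun z hz =>
      ringFiveEleven_mem_span_singleton (coe_toNat_order hx').symm hz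

end FiveEleven

/-! ### Consequences of the data `(20, 26)`. -/

section Data

variable {k : Type*} [Field k] {I : Ideal (ringFiveEleven k)} {f g : ringFiveEleven k}

/-- As `20 + 6j ≡ j` mod 5, powers of `t⁵` fill each residue class from its least order upwards. -/
theorem exists_mem_order_eq_of_generators
    (h : ∀ j < 5, ∃ e ∈ I, (e : k⟦X⟧).order = (20 + 6 * j : ℕ)) {n : ℕ}
    (hn : 20 + 6 * (n % 5) ≤ n) : ∃ e ∈ I, (e : k⟦X⟧).order = n := by
  obtain ⟨e, heI, he⟩ := h (n % 5) (by omega)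
  refine ⟨tFive k ^ ((n - 20 - 6 * (n % 5)) / 5) * e, I.mul_mem_left _ heI, ?_⟩
  rw [order_tFive_pow_mul _ he]
  congr 1
  omega

theorem mem_of_forty_le_order_of_generators
    (h : ∀ j < 5, ∃ e ∈ I, (e : k⟦X⟧).order = (20 + 6 * j : ℕ)) {z : ringFiveEleven k}
    (hz : 40 ≤ (z : k⟦X⟧).order) : z ∈ I := by
  let J : Ideal (ringFiveEleven k) :=
    (Ideal.span {(X : k⟦X⟧) ^ 40}).comap (ringFiveEleven k).val
  have hJ (z : ringFiveEleven k) : z ∈ J ↔ 40 ≤ (z : k⟦X⟧).order := by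
    rw [Ideal.mem_comap, Ideal.mem_span_singleton, X_pow_dvd_iff_le_order]
    rfl
  refine ideal_le_of_orders (J := J) 60 (fun z _ hz => ?_) (fun z hzJ n _ hn => ?_) ((hJ z).2 hz)
  · obtain ⟨e, heI, he⟩ := h 0 (by norm_num)
    exact I.span_singleton_le_iff_mem.2 heI (ringFiveEleven_mem_span_singleton he hz)
  · have h40 : 40 ≤ n := by
      have := (hJ z).1 hzJ
      rw [hn] at this
      exact_mod_cast this
    obtain ⟨e, heI, he⟩ := exists_mem_order_eq_of_generators h (n := n) (by omega)
    exact ⟨e, heI, (hJ e).2 (by rw [he]; exact_mod_cast h40), he⟩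

/-- Multiplication by `g/f`, of order 6, maps `I` into itself. -/
theorem exists_mem_order_eq_generator (hI : I ^ 2 = Ideal.span {f} * I) (hgI : g ∈ I)
    (hfI : f ∈ I) (hf : (f : k⟦X⟧).order = 20) (hg : (g : k⟦X⟧).order = 26) (j : ℕ) :
    ∃ e ∈ I, (e : k⟦X⟧).order = (20 + 6 * j : ℕ) := by
  induction j with
  | zero => exact ⟨f, hfI, by simpa using hf⟩
  | succ j ih =>
    obtain ⟨e, heI, he⟩ := ih
    have hmem : e * g ∈ I ^ 2 := by
      rw [pow_two]
      exact Ideal.mul_mem_mul heI hgI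
    rw [hI, Ideal.mem_span_singleton_mul] at hmem
    obtain ⟨w, hwI, hw⟩ := hmem
    refine ⟨w, hwI, ?_⟩
    refine order_eq_of_mul_eq (z := (e : k⟦X⟧) * (g : k⟦X⟧)) hf ?_ (congrArg Subtype.val hw)
    rw [order_mul, he, hg]
    norm_cast
    omega

theorem exists_mem_order_eq (hI : I ^ 2 = Ideal.span {f} * I) (hgI : g ∈ I)
    (hfI : f ∈ I) (hf : (f : k⟦X⟧).order = 20) (hg : (g : k⟦X⟧).order = 26) {n : ℕ}
    (hn : 20 + 6 * (n % 5) ≤ n) : ∃ e ∈ I, (e : k⟦X⟧).order = n :=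
  exists_mem_order_eq_of_generators
    (fun j _ => exists_mem_order_eq_generator hI hgI hfI hf hg j) hn

theorem mem_of_forty_le_order (hI : I ^ 2 = Ideal.span {f} * I) (hgI : g ∈ I)
    (hfI : f ∈ I) (hf : (f : k⟦X⟧).order = 20) (hg : (g : k⟦X⟧).order = 26)
    {z : ringFiveEleven k} (hz : 40 ≤ (z : k⟦X⟧).order) : z ∈ I :=
  mem_of_forty_le_order_of_generators
    (fun j _ => exists_mem_order_eq_generator hI hgI hfI hf hg j) hz

/-- If `v I ⊆ (f)`, the order of `v` is attained in `I`: otherwise some element of `k[[t⁵, t¹¹]]`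
would have order `39`. -/
theorem order_of_mul_mem_span_singleton (hI : I ^ 2 = Ideal.span {f} * I) (hgI : g ∈ I)
    (hfI : f ∈ I) (hf : (f : k⟦X⟧).order = 20) (hg : (g : k⟦X⟧).order = 26)
    {v : ringFiveEleven k} (hv : ∀ e ∈ I, v * e ∈ Ideal.span {f}) {n : ℕ}
    (hn : (v : k⟦X⟧).order = n) : 20 + 6 * (n % 5) ≤ n := by
  by_contra hlt
  have hH := mem_closure_five_eleven.1 (semigroupRing_mem_of_order_eq v hn)
  -- The symmetry `s ↦ 19 - s` of `⟨5, 6⟩`, shifted by 20 on both sides: if `n` is not an order in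
  -- `I`, then `59 - n` is. Division by `f` leaves `59 - 20 = 39`.
  obtain ⟨e, heI, he⟩ := exists_mem_order_eq hI hgI hfI hf hg (n := 59 - n) (by omega)
  obtain ⟨w, hw⟩ := Ideal.mem_span_singleton.1 (hv e heI)
  have h39 : (w : k⟦X⟧).order = (39 : ℕ) := by
    refine order_eq_of_mul_eq (z := (v : k⟦X⟧) * (e : k⟦X⟧)) hf ?_ (congrArg Subtype.val hw.symm)
    rw [order_mul, hn, he]
    norm_cast
    omega
  have := mem_closure_five_eleven.1 (semigroupRing_mem_of_order_eq w h39)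
  omega

theorem order_of_mem (hI : I ^ 2 = Ideal.span {f} * I) (hgI : g ∈ I)
    (hfI : f ∈ I) (hf : (f : k⟦X⟧).order = 20) (hg : (g : k⟦X⟧).order = 26)
    {v : ringFiveEleven k} (hv : v ∈ I) {n : ℕ}
    (hn : (v : k⟦X⟧).order = n) : 20 + 6 * (n % 5) ≤ n := by
  refine order_of_mul_mem_span_singleton hI hgI hfI hf hg (fun e he => ?_) hn
  have : v * e ∈ I ^ 2 := by
    rw [pow_two]
    exact Ideal.mul_mem_mul hv he
  rw [hI] at this
  exact Ideal.mul_le_left this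

/-- The colon ideal `(f) : g` contains `I` and multiplies `I` into `(f)`, so its orders are already
attained in `I`. -/
theorem mem_of_mul_mem_span_singleton (hI : I ^ 2 = Ideal.span {f} * I)
    (hIfg : I = Ideal.span {f, g}) (hf : (f : k⟦X⟧).order = 20) (hg : (g : k⟦X⟧).order = 26)
    {v : ringFiveEleven k} (hv : v * g ∈ Ideal.span {f}) : v ∈ I := by
  have hfI : f ∈ I := hIfg ▸ Ideal.subset_span (by simp)
  have hgI : g ∈ I := hIfg ▸ Ideal.subset_span (by simp)
  let J : Ideal (ringFiveEleven k) :=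
    Submodule.comap (LinearMap.toSpanSingleton (ringFiveEleven k) _ g) (Ideal.span {f})
  have hJ (z : ringFiveEleven k) : z ∈ J ↔ z * g ∈ Ideal.span {f} := Iff.rfl
  refine ideal_le_of_orders (J := J) 40
    (fun z _ hz => mem_of_forty_le_order hI hgI hfI hf hg hz) (fun z hz n _ hn => ?_) ((hJ v).2 hv)
  have hzI : ∀ e ∈ I, z * e ∈ Ideal.span {f} := by
    intro e he
    rw [hIfg] at he
    obtain ⟨a, b, rfl⟩ := Ideal.mem_span_pair.1 he
    have : z * (a * f + b * g) = z * a * f + b * (z * g) := by ring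
    rw [this]
    exact Ideal.add_mem _ (Ideal.mul_mem_left _ _ (Ideal.mem_span_singleton_self f))
      (Ideal.mul_mem_left _ _ ((hJ z).1 hz))
  obtain ⟨e, heI, he⟩ := exists_mem_order_eq hI hgI hfI hf hg
    (order_of_mul_mem_span_singleton hI hgI hfI hf hg hzI hn)
  refine ⟨e, heI, (hJ e).2 ?_, he⟩
  have : e * g ∈ I ^ 2 := by
    rw [pow_two]
    exact Ideal.mul_mem_mul heI hgI
  rw [hI] at this
  exact Ideal.mul_le_left this

/-- If `uf + vg ∈ I² = fI`, then `vg ∈ (f)`, so `v ∈ I`; then `uf ∈ fI`, and cancelling `f` gives `u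
∈ I`. -/
theorem free_cotangent (hI : I ^ 2 = Ideal.span {f} * I)
    (hIfg : I = Ideal.span {f, g}) (hf : (f : k⟦X⟧).order = 20) (hg : (g : k⟦X⟧).order = 26) :
    Module.Free (ringFiveEleven k ⧸ I) I.Cotangent := by
  have hfI : f ∈ I := hIfg ▸ Ideal.subset_span (by simp)
  have hgI : g ∈ I := hIfg ▸ Ideal.subset_span (by simp)
  have hf0 : f ≠ 0 := by
    rintro rfl
    simp at hf
  have hsmul (a : ringFiveEleven k) (x : I) :
      Ideal.Quotient.mk I a • I.toCotangent x = I.toCotangent (a • x) := rfl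
  have hli : LinearIndependent (ringFiveEleven k ⧸ I)
      ![I.toCotangent ⟨f, hfI⟩, I.toCotangent ⟨g, hgI⟩] := by
    rw [LinearIndependent.pair_iff]
    intro s t hst
    obtain ⟨u, rfl⟩ := Ideal.Quotient.mk_surjective s
    obtain ⟨v, rfl⟩ := Ideal.Quotient.mk_surjective t
    rw [hsmul, hsmul, ← map_add, Ideal.toCotangent_eq_zero] at hst
    have hst : u * f + v * g ∈ I ^ 2 := hst
    have hv : v ∈ I := by
      refine mem_of_mul_mem_span_singleton hI hIfg hf hg ?_
      rw [hI] at hst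
      have h := Ideal.sub_mem _ (Ideal.mul_le_left hst)
        (Ideal.mul_mem_left _ u (Ideal.mem_span_singleton_self f))
      rwa [add_sub_cancel_left] at h
    have hvg : v * g ∈ I ^ 2 := by
      rw [pow_two]
      exact Ideal.mul_mem_mul hv hgI
    have huf := Ideal.sub_mem _ hst hvg
    rw [add_sub_cancel_right, hI, Ideal.mem_span_singleton_mul] at huf
    obtain ⟨w, hwI, hw⟩ := huf
    have huw : w = u := mul_left_cancel₀ hf0 (by rw [hw, mul_comm])
    exact ⟨Ideal.Quotient.eq_zero_iff_mem.2 (huw ▸ hwI), Ideal.Quotient.eq_zero_iff_mem.2 hv⟩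
  refine Module.Free.of_basis (Module.Basis.mk hli ?_)
  intro x _
  obtain ⟨⟨x, hx⟩, rfl⟩ := I.toCotangent_surjective x
  have hx' := hx
  rw [hIfg] at hx'
  obtain ⟨a, b, hab⟩ := Ideal.mem_span_pair.1 hx'
  have : (⟨x, hx⟩ : I) = a • ⟨f, hfI⟩ + b • ⟨g, hgI⟩ := Subtype.ext hab.symm
  rw [this, map_add, ← hsmul, ← hsmul]
  exact Submodule.add_mem _ (Submodule.smul_mem _ _ (Submodule.subset_span ⟨0, rfl⟩))
    (Submodule.smul_mem _ _ (Submodule.subset_span ⟨1, rfl⟩))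

theorem isUlrich_of_hasData (h : HasData I 20 26) : IsUlrich I := by
  obtain ⟨f, g, hIfg, hI, hf, hg⟩ := h
  have hf : (f : k⟦X⟧).order = 20 := hf
  have hg : (g : k⟦X⟧).order = 26 := hg
  have hfI : f ∈ I := hIfg ▸ Ideal.subset_span (by simp)
  have hgI : g ∈ I := hIfg ▸ Ideal.subset_span (by simp)
  have hle : Ideal.span {f} ≤ I := I.span_singleton_le_iff_mem.2 hfI
  have hne : I ≠ ⊤ := by
    rintro rfl
    have := order_of_mem hI hgI hfI hf hg (v := 1) trivial (n := 0) (by simp)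
    omega
  refine ⟨radical_eq_maximalIdeal 40 (fun z hz => mem_of_forty_le_order hI hgI hfI hf hg hz) hne,
    ⟨Ideal.span {f}, ⟨radical_eq_maximalIdeal (20 + 40) (fun z hz =>
      ringFiveEleven_mem_span_singleton hf hz) fun h => hne (top_le_iff.1 (h ▸ hle)),
      1, fun _ => f, by exact_mod_cast ringKrullDim_ringFiveEleven k, by simp⟩,
      ⟨hle, 1, by simpa using hI⟩, fun h => ?_, hI⟩, free_cotangent hI hIfg hf hg⟩
  rw [h] at hgI
  obtain ⟨w, hw⟩ := Ideal.mem_span_singleton.1 hgI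
  -- `I ≠ (f)` because `g/f` has order 6, a gap of the semigroup.
  have h6 : (w : k⟦X⟧).order = (6 : ℕ) :=
    order_eq_of_mul_eq hf (by rw [hg]; norm_num) (congrArg Subtype.val hw.symm)
  have := mem_closure_five_eleven.1 (semigroupRing_mem_of_order_eq w h6)
  omega

end Data

/-! ### The normal forms possess the data. -/

theorem PowerSeries.order_X_pow_mul_of_constantCoeff_ne_zero {k : Type*} [Field k] {u z : k⟦X⟧}
    {n : ℕ} (h : z = X ^ n * u) (hu : constantCoeff u ≠ 0) : z.order = n := by
  have hu0 : u.order = 0 := by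
    by_contra h0
    exact hu (order_ne_zero_iff_constCoeff_eq_zero.1 h0)
  rw [h, order_mul, order_X_pow, hu0, add_zero]

section NormalForm

variable {k : Type*} [Field k] [CharP k 2]

variable (k) in
theorem PowerSeries.two_eq_zero : (2 : k⟦X⟧) = 0 := by
  have h : (2 : k) = 0 := CharTwo.two_eq_zero
  rw [← map_ofNat (C (R := k)) 2, h, map_zero]

theorem hasData_of_normalForm {α δ τ : k} (hα : α ≠ 0) {f g : ringFiveEleven k}
    (hf : (f : k⟦X⟧) = X ^ 20 + C α * X ^ 21 + C (α ^ 2) * X ^ 22 + C (α ^ 7) * X ^ 27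
      + C δ * X ^ 33) (hg : (g : k⟦X⟧) = X ^ 26 + C τ * X ^ 33) :
    HasData (Ideal.span {f, g}) 20 26 := by
  set I := Ideal.span {f, g} with hI
  have h2 := PowerSeries.two_eq_zero k
  have hfI : f ∈ I := Ideal.subset_span (by simp)
  have hgI : g ∈ I := Ideal.subset_span (by simp)
  rw [map_pow, map_pow] at hf
  have hfo : (f : k⟦X⟧).order = (20 : ℕ) :=
    order_X_pow_mul_of_constantCoeff_ne_zero (u := 1 + C α * X + C α ^ 2 * X ^ 2 +
      C α ^ 7 * X ^ 7 + C δ * X ^ 13) (by rw [hf]; ring) (by simp)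
  have hgo : (g : k⟦X⟧).order = (26 : ℕ) :=
    order_X_pow_mul_of_constantCoeff_ne_zero (u := 1 + C τ * X ^ 7) (by rw [hg]; ring) (by simp)
  let c : k → ringFiveEleven k := algebraMap k _
  have hc (r : k) : (c r : k⟦X⟧) = C r := rfl
  have hx := coe_tFive (k := k)
  have hy := coe_tEleven (k := k)
  set x := tFive k
  set y := tEleven k
  -- Equal leading terms cancel in characteristic 2: `t³¹` in `p`, `t³⁶` and `t³⁷` in `q`, and `t⁴³`
  -- in `αyp + xq` below. The surviving leading coefficients are `α`, `α²`, `α³`.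
  set p := x * g + y * f with hp
  set q := x * y * f + x ^ 2 * g + c α * y * g with hq
  have hpI : p ∈ I := I.add_mem (I.mul_mem_left _ hgI) (I.mul_mem_left _ hfI)
  have hqI : q ∈ I := I.add_mem (I.add_mem (I.mul_mem_left _ hfI) (I.mul_mem_left _ hgI))
    (I.mul_mem_left _ hgI)
  have hpc : (p : k⟦X⟧) = X ^ 32 * (C α + C α ^ 2 * X + (C τ + C α ^ 7) * X ^ 6 +
      C δ * X ^ 12) := by
    rw [hp]
    push_cast
    rw [hx, hy, hf, hg]
    linear_combination X ^ 31 * h2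
  have hqc : (q : k⟦X⟧) = X ^ 38 * (C α ^ 2 + (C α ^ 7 + C τ) * X ^ 5 + C α * C τ * X ^ 6 +
      C δ * X ^ 11) := by
    rw [hq]
    push_cast
    rw [hx, hy, hc, hf, hg]
    linear_combination (X ^ 36 + C α * X ^ 37) * h2
  have hrc : ((c α * y * p + x * q : ringFiveEleven k) : k⟦X⟧) = X ^ 44 * (C α ^ 3 +
      (C α ^ 7 + C τ) * X ^ 4 + (2 * C α * C τ + C α ^ 8) * X ^ 5 + C δ * X ^ 10 +
      C α * C δ * X ^ 11) := by
    push_cast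
    rw [hx, hy, hc, hpc, hqc]
    linear_combination (C α ^ 2 * X ^ 43) * h2
  have h40 {z : ringFiveEleven k} (hz : 40 ≤ (z : k⟦X⟧).order) : z ∈ I := by
    refine mem_of_forty_le_order_of_generators (fun j hj => ?_) hz
    interval_cases j
    · exact ⟨f, hfI, hfo⟩
    · exact ⟨g, hgI, hgo⟩
    · exact ⟨p, hpI, order_X_pow_mul_of_constantCoeff_ne_zero hpc (by simpa using hα)⟩
    · exact ⟨q, hqI, order_X_pow_mul_of_constantCoeff_ne_zero hqc (by simpa using hα)⟩
    · exact ⟨_, I.add_mem (I.mul_mem_left _ hpI) (I.mul_mem_left _ hqI),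
        order_X_pow_mul_of_constantCoeff_ne_zero hrc (by simpa using hα)⟩
  obtain ⟨w, hwI, hw⟩ : ∃ w ∈ I, f * w = g ^ 2 := by
    obtain ⟨β, hβ⟩ : ∃ β, α * β = 1 := ⟨α⁻¹, mul_inv_cancel₀ hα⟩
    have hβ : C α * C β = 1 := by rw [← map_mul, hβ, map_one]
    -- `W` agrees with `g²/f` modulo `t⁴⁰`. With `s = αt`, the inverse of `1 + s + s² + s⁷` is `1 +
    -- s + s³ + s⁴ + s⁶` modulo `s⁸`; the term `α⁷t²⁷` of `f` removes the forbidden `t³⁹`. The last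
    -- two summands of `W` cancel unwanted terms in `t³⁷` and `t³⁸`.
    let W : ringFiveEleven k := c β * p + c α ^ 3 * x ^ 3 * f + c α ^ 5 * y * g +
      c τ * c β ^ 3 * q
    have hWI : W ∈ I := I.add_mem (I.add_mem (I.add_mem (I.mul_mem_left _ hpI)
      (I.mul_mem_left _ hfI)) (I.mul_mem_left _ hgI)) (I.mul_mem_left _ hqI)
    obtain ⟨S, hS⟩ : ∃ S : k⟦X⟧, (W : k⟦X⟧) = X ^ 32 + C α * X ^ 33 + C α ^ 3 * X ^ 35 +
        C α ^ 4 * X ^ 36 + C α ^ 6 * X ^ 38 + X ^ 40 * S := by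
      refine ⟨C α ^ 10 * X ^ 2 + (C τ * C α ^ 4 + C τ ^ 2 * C β ^ 3) * X ^ 3 +
        (C β * C δ + C α ^ 5 * C τ + C τ ^ 2 * C β ^ 2) * X ^ 4 + C α ^ 3 * C δ * X ^ 8 +
        C τ * C β ^ 3 * C δ * X ^ 9, ?_⟩
      push_cast [W]
      simp only [hc]
      rw [hpc, hqc, hx, hy, hf, hg]
      generalize C α = a at *
      generalize C β = b at *
      linear_combination (X ^ 32 + a * X ^ 33 + a ^ 6 * X ^ 38 +
        b * C τ * (a * b + 1) * X ^ 38 + C τ * a ^ 4 * (a ^ 2 * b ^ 2 + a * b + 1) * X ^ 43 +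
        C τ ^ 2 * b ^ 2 * X ^ 44) * hβ + (a ^ 5 * X ^ 37 + b * C τ * X ^ 38) * h2
    have hz : ((20 + 40 : ℕ) : ℕ∞) ≤ ((g ^ 2 - f * W : ringFiveEleven k) : k⟦X⟧).order := by
      rw [← X_pow_dvd_iff_le_order]
      refine ⟨C τ ^ 2 * X ^ 6 - (C α ^ 10 * X ^ 2 + C α ^ 11 * X ^ 3 + C α ^ 13 * X ^ 5 +
        C δ * X ^ 5 * (1 + C α * X + C α ^ 3 * X ^ 3 + C α ^ 4 * X ^ 4 + C α ^ 6 * X ^ 6)) -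
        (1 + C α * X + C α ^ 2 * X ^ 2 + C α ^ 7 * X ^ 7 + C δ * X ^ 13) * S, ?_⟩
      push_cast
      rw [hS, hf, hg]
      generalize C α = a
      linear_combination (C τ * X ^ 59 - (a * X ^ 53 + a ^ 2 * X ^ 54 + a ^ 3 * X ^ 55 +
        a ^ 4 * X ^ 56 + a ^ 5 * X ^ 57 + a ^ 6 * X ^ 58 + a ^ 7 * X ^ 59 +
        a ^ 8 * X ^ 60)) * h2
    obtain ⟨w, hw, hwo⟩ := ringFiveEleven_exists_mul_eq le_rfl hfo hz
    exact ⟨W + w, I.add_mem hWI (h40 hwo), by rw [mul_add, hw]; ring⟩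
  refine ⟨f, g, rfl, le_antisymm ?_ ?_, hfo, hgo⟩
  · rw [pow_two, Ideal.mul_le]
    intro r hr s hs
    obtain ⟨r1, r2, rfl⟩ := Ideal.mem_span_pair.1 hr
    obtain ⟨s1, s2, rfl⟩ := Ideal.mem_span_pair.1 hs
    refine Ideal.mem_span_singleton_mul.2 ⟨r1 * (s1 * f + s2 * g) + r2 * s1 * g + r2 * s2 * w,
      I.add_mem (I.add_mem (I.mul_mem_left _ hs) (I.mul_mem_left _ hgI)) (I.mul_mem_left _ hwI), ?_⟩
    linear_combination r2 * s2 * hw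
  · rw [pow_two]
    exact Ideal.mul_mono_left (I.span_singleton_le_iff_mem.2 hfI)

end NormalForm

/-! ### Reducing the generators. -/

section Reduction

variable {k : Type*} [Field k] {I : Ideal (ringFiveEleven k)} {f g : ringFiveEleven k}

/-- Gaussian elimination against elements of `I` of each larger order: only exponents of the ring
that are not orders in `I` survive beyond `n`. -/
theorem exists_reduced_mem (hI : I ^ 2 = Ideal.span {f} * I) (hgI : g ∈ I)
    (hfI : f ∈ I) (hf : (f : k⟦X⟧).order = 20) (hg : (g : k⟦X⟧).order = 26)
    {n : ℕ} (hn : n < 40) (hn' : 20 + 6 * (n % 5) ≤ n) :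
    ∃ e ∈ I, (∀ m < n, coeff m (e : k⟦X⟧) = 0) ∧ coeff n (e : k⟦X⟧) = 1 ∧
      ∀ m ≠ n, 20 + 6 * (m % 5) ≤ m → coeff m (e : k⟦X⟧) = 0 := by
  have key : ∀ N : ℕ, ∃ e ∈ I, (∀ m < n, coeff m (e : k⟦X⟧) = 0) ∧
      coeff n (e : k⟦X⟧) = 1 ∧
      ∀ m < N, m ≠ n → 20 + 6 * (m % 5) ≤ m → coeff m (e : k⟦X⟧) = 0 := by
    intro N
    induction N with
    | zero =>
      obtain ⟨e, heI, he⟩ := exists_mem_order_eq hI hgI hfI hf hg hn'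
      obtain ⟨he1, he2⟩ := order_eq_nat.1 he
      refine ⟨algebraMap k _ (coeff n (e : k⟦X⟧))⁻¹ * e, I.mul_mem_left _ heI, ?_, ?_, by simp⟩
      · intro m hm
        rw [MulMemClass.coe_mul, coe_algebraMap_semigroupRing, coeff_C_mul, he2 m hm, mul_zero]
      · rw [MulMemClass.coe_mul, coe_algebraMap_semigroupRing, coeff_C_mul, inv_mul_cancel₀ he1]
    | succ N ih =>
      obtain ⟨e, heI, h0, h1, h⟩ := ih
      by_cases hN : n < N ∧ 20 + 6 * (N % 5) ≤ N
      · obtain ⟨d, hdI, hd⟩ := exists_mem_order_eq hI hgI hfI hf hg hN.2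
        obtain ⟨hd1, hd2⟩ := order_eq_nat.1 hd
        have hc (m : ℕ) : coeff m ((e - algebraMap k _ (coeff N (e : k⟦X⟧) /
            coeff N (d : k⟦X⟧)) * d : ringFiveEleven k) : k⟦X⟧) = coeff m (e : k⟦X⟧) -
              coeff N (e : k⟦X⟧) / coeff N (d : k⟦X⟧) * coeff m (d : k⟦X⟧) := by
          rw [AddSubgroupClass.coe_sub, MulMemClass.coe_mul, coe_algebraMap_semigroupRing, map_sub,
            coeff_C_mul]
        refine ⟨_, I.sub_mem heI (I.mul_mem_left
          (algebraMap k _ (coeff N (e : k⟦X⟧) / coeff N (d : k⟦X⟧))) hdI), fun m hm => ?_, ?_, fun m hm hmn hm' => ?_⟩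
        · rw [hc, h0 m hm, hd2 m (hm.trans hN.1), mul_zero, sub_zero]
        · rw [hc, h1, hd2 n hN.1, mul_zero, sub_zero]
        · rw [hc]
          rcases Nat.lt_succ_iff_lt_or_eq.1 hm with hlt | rfl
          · rw [h m hlt hmn hm', hd2 m hlt, mul_zero, sub_zero]
          · rw [div_mul_cancel₀ _ hd1, sub_self]
      · refine ⟨e, heI, h0, h1, fun m hm hmn hm' => ?_⟩
        rcases Nat.lt_succ_iff_lt_or_eq.1 hm with hlt | rfl
        · exact h m hlt hmn hm'
        · exact h0 m (by omega)
  obtain ⟨e, heI, h0, h1, h⟩ := key 40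
  -- The elimination stops at 40; the whole tail lies in `I` and is subtracted at once.
  have hT : 40 ≤ (mk fun m => if m < 40 then 0 else coeff m (e : k⟦X⟧)).order :=
    nat_le_order _ 40 fun i hi => by rw [coeff_mk, if_pos hi]
  refine ⟨e - ⟨_, mem_ringFiveEleven_of_le_order hT⟩,
    I.sub_mem heI (mem_of_forty_le_order hI hgI hfI hf hg hT), fun m hm => ?_, ?_,
      fun m hmn hm => ?_⟩
  · rw [AddSubgroupClass.coe_sub, map_sub, coeff_mk, if_pos (hm.trans hn), h0 m hm, sub_zero]
  · rw [AddSubgroupClass.coe_sub, map_sub, coeff_mk, if_pos hn, h1, sub_zero]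
  · rw [AddSubgroupClass.coe_sub, map_sub, coeff_mk]
    split_ifs with h40
    · rw [h m h40 hmn hm, sub_zero]
    · rw [sub_self]

/-- `f'I ⊆ I² = fI`, and both products have the same orders because `f` and `f'` do. -/
theorem sq_eq_of_order_eq (hI : I ^ 2 = Ideal.span {f} * I) (hgI : g ∈ I)
    (hfI : f ∈ I) (hf : (f : k⟦X⟧).order = 20) (hg : (g : k⟦X⟧).order = 26)
    {f' : ringFiveEleven k} (hf'I : f' ∈ I) (hf' : (f' : k⟦X⟧).order = 20) :
    I ^ 2 = Ideal.span {f'} * I := by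
  have hle : Ideal.span {f'} * I ≤ I ^ 2 := by
    rw [pow_two]
    exact Ideal.mul_mono_left (I.span_singleton_le_iff_mem.2 hf'I)
  refine le_antisymm (ideal_le_of_orders (20 + 40) (fun z _ hz => ?_) fun z hz n _ hn => ?_) hle
  · obtain ⟨w, hw, hwo⟩ := ringFiveEleven_exists_mul_eq le_rfl hf' hz
    exact Ideal.mem_span_singleton_mul.2 ⟨w, mem_of_forty_le_order hI hgI hfI hf hg hwo, hw⟩
  · rw [hI, Ideal.mem_span_singleton_mul] at hz
    obtain ⟨w, hwI, rfl⟩ := hz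
    have hmem : f' * w ∈ Ideal.span {f'} * I := Ideal.mem_span_singleton_mul.2 ⟨w, hwI, rfl⟩
    refine ⟨f' * w, hmem, hle hmem, ?_⟩
    rw [MulMemClass.coe_mul, order_mul] at hn ⊢
    rw [hf', ← hf, hn]

theorem coeff_eq_zero_of_not_mem (u : ringFiveEleven k) {n : ℕ} (hn : ¬ 11 * (n % 5) ≤ n) :
    coeff n (u : k⟦X⟧) = 0 := by
  by_contra h
  exact hn (mem_closure_five_eleven.1 (u.2 n h))

end Reduction

/-! ### Determining the coefficients. -/

section Classification

variable {k : Type*} [Field k] {I : Ideal (ringFiveEleven k)} {f g : ringFiveEleven k}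

/-- The matrix expressing `f', g'` in `f, g` is triangular modulo the maximal ideal with nonzero
diagonal, hence invertible. -/
theorem eq_span_pair_of_order_eq (hIfg : I = Ideal.span {f, g})
    (hf : (f : k⟦X⟧).order = (20 : ℕ)) (hg : (g : k⟦X⟧).order = (26 : ℕ))
    {f' g' : ringFiveEleven k} (hf'I : f' ∈ I) (hg'I : g' ∈ I)
    (hf' : (f' : k⟦X⟧).order = (20 : ℕ)) (hg' : (g' : k⟦X⟧).order = (26 : ℕ)) :
    I = Ideal.span {f', g'} := by
  have hle : Ideal.span {f', g'} ≤ I := by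
    rw [Ideal.span_le]
    rintro z (rfl | rfl)
    exacts [hf'I, hg'I]
  refine le_antisymm ?_ hle
  rw [hIfg, Ideal.mem_span_pair] at hf'I hg'I
  obtain ⟨u, v, huv⟩ := hf'I
  obtain ⟨u', v', huv'⟩ := hg'I
  obtain ⟨F, hF⟩ := X_pow_dvd_iff_le_order.2 hf.ge
  obtain ⟨G, hG⟩ := X_pow_dvd_iff_le_order.2 hg.ge
  have coeff_comb (u v : ringFiveEleven k) (n : ℕ) :
      coeff (20 + n) ((u * f + v * g : ringFiveEleven k) : k⟦X⟧) =
        coeff n ((u : k⟦X⟧) * F) + if 6 ≤ n then coeff (n - 6) ((v : k⟦X⟧) * G) else 0 := by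
    have : ((u * f + v * g : ringFiveEleven k) : k⟦X⟧) =
        X ^ 20 * ((u : k⟦X⟧) * F + X ^ 6 * ((v : k⟦X⟧) * G)) := by
      push_cast
      rw [hF, hG]
      ring
    rw [this, coeff_X_pow_mul', if_pos (by omega), Nat.add_sub_cancel_left, map_add,
      coeff_X_pow_mul']
  have hF0 : coeff 0 F ≠ 0 := by
    have h := (order_eq_nat.1 hf).1
    rwa [hF, coeff_X_pow_mul', if_pos le_rfl] at h
  have hu0 : coeff 0 (u : k⟦X⟧) ≠ 0 := by
    have h := (order_eq_nat.1 hf').1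
    rw [← huv, coeff_comb u v 0] at h
    simp [coeff_mul] at h
    simpa using h.1
  have hu'0 : coeff 0 (u' : k⟦X⟧) = 0 := by
    have h := (order_eq_nat.1 hg').2 20 (by norm_num)
    rw [← huv', coeff_comb u' v' 0] at h
    simpa [coeff_mul, show constantCoeff F ≠ 0 by simpa using hF0] using h
  have h1 := coeff_eq_zero_of_not_mem u' (n := 1) (by norm_num)
  have h2 := coeff_eq_zero_of_not_mem u' (n := 2) (by norm_num)
  have h3 := coeff_eq_zero_of_not_mem u' (n := 3) (by norm_num)
  have h4 := coeff_eq_zero_of_not_mem u' (n := 4) (by norm_num)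
  have h6 := coeff_eq_zero_of_not_mem u' (n := 6) (by norm_num)
  -- With the gaps 1, 2, 3, 4, 6, this leaves `u'f` no term at `t²⁶`, so the leading term of `g'`
  -- must come from `v'g`.
  have h5 : coeff 5 (u' : k⟦X⟧) = 0 := by
    have h := (order_eq_nat.1 hg').2 25 (by norm_num)
    rw [← huv', coeff_comb u' v' 5, coeff_mul] at h
    simp only [Finset.Nat.antidiagonal_succ, Finset.sum_cons, Finset.sum_map] at h
    simp [hu'0, h1, h2, h3, h4, show constantCoeff F ≠ 0 by simpa using hF0] at h
    exact h
  have hv'0 : coeff 0 (v' : k⟦X⟧) ≠ 0 := by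
    intro hv
    have h := (order_eq_nat.1 hg').1
    rw [← huv', coeff_comb u' v' 6, coeff_mul, coeff_mul] at h
    simp only [Finset.Nat.antidiagonal_succ, Finset.sum_cons, Finset.sum_map] at h
    simp [hu'0, h1, h2, h3, h4, h5, h6, show constantCoeff (v' : k⟦X⟧) = 0 by simpa using hv] at h
  obtain ⟨d, hd⟩ : IsUnit (u * v' - u' * v) := by
    apply semigroupRing_isUnit
    push_cast
    rw [map_sub, map_mul, map_mul]
    simp only [coeff_zero_eq_constantCoeff] at hu0 hu'0 hv'0
    rw [hu'0, zero_mul, sub_zero]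
    exact mul_ne_zero hu0 hv'0
  have hd' : (u * v' - u' * v) * ↑d⁻¹ = 1 := by rw [← hd, Units.mul_inv]
  rw [hIfg, Ideal.span_le]
  rintro z (rfl | rfl)
  · refine Ideal.mem_span_pair.2 ⟨v' * ↑d⁻¹, -v * ↑d⁻¹, ?_⟩
    rw [← huv, ← huv']
    linear_combination z * hd'
  · refine Ideal.mem_span_pair.2 ⟨-u' * ↑d⁻¹, u * ↑d⁻¹, ?_⟩
    rw [← huv, ← huv']
    linear_combination z * hd'

theorem coeff_relations [CharP k 2] {a a₂ c δ b τ : k}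
    (hf : (f : k⟦X⟧) = X ^ 20 + C a * X ^ 21 + C a₂ * X ^ 22 + C c * X ^ 27 + C δ * X ^ 33)
    (hg : (g : k⟦X⟧) = X ^ 26 + C b * X ^ 27 + C τ * X ^ 33)
    {w u v : ringFiveEleven k} (hw : f * w = g ^ 2) (huv : u * f + v * g = w)
    (hwo : (w : k⟦X⟧).order = (32 : ℕ)) :
    a ≠ 0 ∧ b = 0 ∧ a₂ = a ^ 2 ∧ c = a ^ 7 := by
  have hz (z : ringFiveEleven k) {n : ℕ} (hn : ¬ 11 * (n % 5) ≤ n) : coeff n (z : k⟦X⟧) = 0 :=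
    coeff_eq_zero_of_not_mem z hn
  have hw0 (n : ℕ) (hn : n < 32) := (order_eq_nat.1 hwo).2 n hn
  have h2 : (2 : k) = 0 := CharTwo.two_eq_zero
  have hw (n : ℕ) := congrArg (fun z : ringFiveEleven k => coeff (52 + n) (z : k⟦X⟧)) hw
  have hgg : ((g ^ 2 : ringFiveEleven k) : k⟦X⟧) =
      X ^ 52 + C (b ^ 2) * X ^ 54 + C (τ ^ 2) * X ^ 66 := by
    push_cast
    rw [hg, map_pow, map_pow]
    linear_combination (C b * X ^ 53 + C τ * X ^ 59 + C b * C τ * X ^ 60) *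
      PowerSeries.two_eq_zero k
  have hfw : ((f * w : ringFiveEleven k) : k⟦X⟧) = X ^ 20 * (w : k⟦X⟧) +
      C a * (X ^ 21 * (w : k⟦X⟧)) + C a₂ * (X ^ 22 * (w : k⟦X⟧)) +
      C c * (X ^ 27 * (w : k⟦X⟧)) + C δ * (X ^ 33 * (w : k⟦X⟧)) := by
    push_cast
    rw [hf]
    ring
  have huv' : (w : k⟦X⟧) = X ^ 20 * (u : k⟦X⟧) +
      C a * (X ^ 21 * (u : k⟦X⟧)) + C a₂ * (X ^ 22 * (u : k⟦X⟧)) +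
      C c * (X ^ 27 * (u : k⟦X⟧)) + C δ * (X ^ 33 * (u : k⟦X⟧)) + (X ^ 26 * (v : k⟦X⟧) +
      C b * (X ^ 27 * (v : k⟦X⟧)) + C τ * (X ^ 33 * (v : k⟦X⟧))) := by
    rw [← huv]
    push_cast
    rw [hf, hg]
    ring
  have huv (n : ℕ) := congrArg (coeff n) huv'
  simp only [hfw, hgg, map_add, coeff_C_mul, coeff_X_pow, coeff_X_pow_mul'] at hw huv
  have e0 := hw 0
  have e1 := hw 1
  have e2 := hw 2
  have e3 := hw 3
  have e4 := hw 4
  have e5 := hw 5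
  have e6 := hw 6
  have e7 := hw 7
  have d20 := huv 20
  have d25 := huv 25
  have d26 := huv 26
  have d30 := huv 30
  have d31 := huv 31
  have d32 := huv 32
  have d33 := huv 33
  norm_num [hw0, hz w (n := 34), hz w (n := 39)] at e0 e1 e2 e3 e4 e5 e6 e7
  norm_num [hw0] at d20
  norm_num [hw0, hz u (n := 3), hz u (n := 4), ← d20] at d25
  norm_num [hw0, hz u (n := 4), hz u (n := 6), ← d20, ← d25] at d26
  norm_num [hw0, hz u (n := 3), hz u (n := 8), hz u (n := 9), hz v (n := 3), hz v (n := 4),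
    ← d20, ← d25, ← d26] at d30
  norm_num [hw0, hz u (n := 4), hz u (n := 9), hz v (n := 4), ← d20, ← d25, ← d26, ← d30] at d31
  norm_num [hz u (n := 12), hz v (n := 6), ← d20, ← d25, ← d26, ← d30] at d32
  norm_num [hz u (n := 12), hz u (n := 13), hz u (n := 6), hz v (n := 6), hz v (n := 7),
    ← d20, ← d25, ← d26, ← d30] at d33
  clear hw huv huv' hfw hgg hw0 hz
  generalize coeff 11 (u : k⟦X⟧) = s at *
  generalize coeff 5 (v : k⟦X⟧) = r at *
  generalize coeff 33 (w : k⟦X⟧) = w₃₃ at *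
  generalize coeff 35 (w : k⟦X⟧) = w₃₅ at *
  generalize coeff 36 (w : k⟦X⟧) = w₃₆ at *
  generalize coeff 37 (w : k⟦X⟧) = w₃₇ at *
  generalize coeff 38 (w : k⟦X⟧) = w₃₈ at *
  rw [e0] at e1 e2 e7 d32
  -- Membership `w = uf + vg` enters here: degree 31 gives `r = -s`, and degree 32 gives `as + br =
  -- 1`.
  have hs : s * (a - b) = 1 := by linear_combination b * d31 - d32
  have h33 : w₃₃ = a := by linear_combination e1 - a * h2
  have ha₂ : a₂ = a * (a - b) := by
    linear_combination -(a - b) * d33 + (a - b) * h33 - a₂ * hs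
  -- Degree 54 of `fw = g²`, with no `t³⁴` in `w`; then `a - b` is cancelled by its inverse `s`.
  have hb : b * (a - b) = 0 := by
    linear_combination e2 - a * h33 - ha₂ - (a ^ 2 - a * b) * h2
  have hb : b = 0 := by linear_combination s * hb - b * hs
  subst hb
  have ha₂ : a₂ = a ^ 2 := by linear_combination ha₂
  subst ha₂
  subst h33
  have h35 : w₃₅ = w₃₃ ^ 3 := by linear_combination e3 - w₃₃ ^ 3 * h2
  subst h35
  have h36 : w₃₆ = w₃₃ ^ 4 := by linear_combination e4 - w₃₃ ^ 4 * h2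
  subst h36
  have h37 : w₃₇ = 0 := by linear_combination e5 - w₃₃ ^ 5 * h2
  subst h37
  have h38 : w₃₈ = w₃₃ ^ 6 := by linear_combination e6 - w₃₃ ^ 6 * h2
  subst h38
  -- Degree 59, where `w` has no `t³⁹`, gives `c = a⁷`.
  refine ⟨?_, rfl, rfl, by linear_combination e7 - w₃₃ ^ 7 * h2⟩
  rintro rfl
  simp at hs

theorem exists_normalForm [CharP k 2] (h : HasData I 20 26) :
    ∃ α δ τ : k, α ≠ 0 ∧ ∃ f g : ringFiveEleven k,
      (f : k⟦X⟧) = X ^ 20 + C α * X ^ 21 + C (α ^ 2) * X ^ 22 + C (α ^ 7) * X ^ 27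
        + C δ * X ^ 33 ∧
      (g : k⟦X⟧) = X ^ 26 + C τ * X ^ 33 ∧ I = Ideal.span {f, g} := by
  obtain ⟨f₀, g₀, hIfg, hI, hf₀, hg₀⟩ := h
  have hf₀I : f₀ ∈ I := hIfg ▸ Ideal.subset_span (by simp)
  have hg₀I : g₀ ∈ I := hIfg ▸ Ideal.subset_span (by simp)
  obtain ⟨f, hfI, hf0, hf1, hf⟩ := exists_reduced_mem hI hg₀I hf₀I hf₀ hg₀ (n := 20)
    (by norm_num) (by norm_num)
  obtain ⟨g, hgI, hg0, hg1, hg⟩ := exists_reduced_mem hI hg₀I hf₀I hf₀ hg₀ (n := 26)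
    (by norm_num) (by norm_num)
  have hfo : (f : k⟦X⟧).order = (20 : ℕ) := order_eq_nat.2 ⟨by simp [hf1], hf0⟩
  have hgo : (g : k⟦X⟧).order = (26 : ℕ) := order_eq_nat.2 ⟨by simp [hg1], hg0⟩
  have hspan := eq_span_pair_of_order_eq hIfg hf₀ hg₀ hfI hgI hfo hgo
  have hI' := sq_eq_of_order_eq hI hg₀I hf₀I hf₀ hg₀ hfI hfo
  -- Past 20, the semigroup elements that are not orders in `I` are 21, 22, 27, 33.
  have coeff_f (m : ℕ) (h20 : m ≠ 20) (h21 : m ≠ 21) (h22 : m ≠ 22) (h27 : m ≠ 27)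
      (h33 : m ≠ 33) : coeff m (f : k⟦X⟧) = 0 := by
    by_cases hH : 11 * (m % 5) ≤ m
    · by_cases hlt : m < 20
      · exact hf0 m hlt
      · exact hf m h20 (by omega)
    · exact coeff_eq_zero_of_not_mem f hH
  have coeff_g (m : ℕ) (h26 : m ≠ 26) (h27 : m ≠ 27)
      (h33 : m ≠ 33) : coeff m (g : k⟦X⟧) = 0 := by
    by_cases hH : 11 * (m % 5) ≤ m
    · by_cases hlt : m < 26
      · exact hg0 m hlt
      · exact hg m h26 (by omega)
    · exact coeff_eq_zero_of_not_mem g hH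
  have hf' : (f : k⟦X⟧) = X ^ 20 + C (coeff 21 (f : k⟦X⟧)) * X ^ 21 +
      C (coeff 22 (f : k⟦X⟧)) * X ^ 22 + C (coeff 27 (f : k⟦X⟧)) * X ^ 27 +
      C (coeff 33 (f : k⟦X⟧)) * X ^ 33 := by
    ext m
    simp only [map_add, coeff_C_mul, coeff_X_pow]
    by_cases h : m = 20 ∨ m = 21 ∨ m = 22 ∨ m = 27 ∨ m = 33
    · rcases h with rfl | rfl | rfl | rfl | rfl <;> simp [hf1]
    · push Not at h
      rw [coeff_f m h.1 h.2.1 h.2.2.1 h.2.2.2.1 h.2.2.2.2]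
      simp [h]
  have hg' : (g : k⟦X⟧) = X ^ 26 + C (coeff 27 (g : k⟦X⟧)) * X ^ 27 +
      C (coeff 33 (g : k⟦X⟧)) * X ^ 33 := by
    ext m
    simp only [map_add, coeff_C_mul, coeff_X_pow]
    by_cases h : m = 26 ∨ m = 27 ∨ m = 33
    · rcases h with rfl | rfl | rfl <;> simp [hg1]
    · push Not at h
      rw [coeff_g m h.1 h.2.1 h.2.2]
      simp [h]
  have hg2 : g ^ 2 ∈ I ^ 2 := Ideal.pow_mem_pow hgI 2
  rw [hI', Ideal.mem_span_singleton_mul] at hg2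
  obtain ⟨w, hwI, hw⟩ := hg2
  have hwo : (w : k⟦X⟧).order = (32 : ℕ) := by
    refine order_eq_of_mul_eq (z := (g : k⟦X⟧) ^ 2) hfo ?_ (congrArg Subtype.val hw)
    rw [order_pow, hgo]
    norm_num
  rw [hspan] at hwI
  obtain ⟨u, v, huv⟩ := Ideal.mem_span_pair.1 hwI
  obtain ⟨hα, hb, h22, h27⟩ := coeff_relations hf' hg' hw huv hwo
  refine ⟨_, coeff 33 (f : k⟦X⟧), coeff 33 (g : k⟦X⟧), hα, f, g, ?_, ?_, hspan⟩
  · rw [← h22, ← h27]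
    exact hf'
  · rw [hb, map_zero, zero_mul, add_zero] at hg'
    exact hg'

end Classification

theorem mainTheorem5 (k : Type*) [Field k] [CharP k 2] :
    {I : Ideal (semigroupRing k (AddSubmonoid.closure {5, 11})) | IsUlrich I ∧ HasData I 20 26} =
    {I : Ideal (semigroupRing k (AddSubmonoid.closure {5, 11})) |
      ∃ α δ τ : k, α ≠ 0 ∧ ∃ f g : semigroupRing k (AddSubmonoid.closure {5, 11}),
        (f : k⟦X⟧) = X ^ 20 + C α * X ^ 21 + C (α ^ 2) * X ^ 22 + C (α ^ 7) * X ^ 27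
          + C δ * X ^ 33 ∧
        (g : k⟦X⟧) = X ^ 26 + C τ * X ^ 33 ∧
        I = Ideal.span {f, g}} := by
  ext I
  constructor
  · rintro ⟨-, h⟩
    exact exists_normalForm h
  · rintro ⟨α, δ, τ, hα, f, g, hf, hg, rfl⟩
    have h := hasData_of_normalForm hα hf hg
    exact ⟨isUlrich_of_hasData h, h⟩
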